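/- Let $n\ge 0$ be an integer and let $\mathrm{Br}_n$ be the braid group on $n$ strands, given by its dual (Birman--Ko--Lee) presentation with band generators $a_{ij}$, $1\le i<j\le n$, and defining relations $$a_{ij}a_{kl}=a_{kl}a_{ij}\ \text{ if } (k-i)(k-j)(l-i)(l-j)>0,\qquad a_{ij}a_{ik}=a_{jk}a_{ij}=a_{ik}a_{jk}\ \text{ if } i<j<k .$$ Let $M=(m_{ij})$ be a symmetric $n\times n$ matrix of non-negative integers of large type, i.e. $m_{ij}\notin\{1,2\}$ for all $1\le i<j\le n$, and let $$E_M=\left\langle a_{ij}^{m_{ij}},\ 1\le i<j\le n\right\rangle\subset \mathrm{Br}_n .$$ Then the elements $b_{ij}=a_{ij}^{m_{ij}}$, $i<j$, with $m_{ij}\ge 3$ (equivalently $m_{ij}\ne 0$) generate $E_M$, and in these generators $E_M$ has the presentation $$\left\langle\, b_{ij},\ i<j,\ m_{ij}\neq 0 \ \middle|\ b_{ij}b_{kl}=b_{kl}b_{ij}\ \text{ whenever } a_{ij}a_{kl}=a_{kl}a_{ij} \text{ in } \mathrm{Br}_n \,\right\rangle ;$$ that is, the group defined by this presentation maps isomorphically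 onto $E_M$ by sending each generator $b_{ij}$ to $a_{ij}^{m_{ij}}$. In particular $E_M$ is a right-angled Artin group. -/

import Mathlib

/-- Index pairs `ij` with `i < j`, labelling the band generators on `n` strands
(the strands are numbered by `Fin n`). -/
abbrev BandIndex (n : ℕ) : Type := {p : Fin n × Fin n // p.1 < p.2}

/-- The band generator `a_{ij}`, `i < j`, as a letter of the free group. -/
abbrev bandLetter {n : ℕ} (i j : Fin n) (h : i < j) : FreeGroup (BandIndex n) :=
  FreeGroup.of ⟨(i, j), h⟩

/-- The relators of the dual (Birman–Ko–Lee) presentation of the braid group: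
`a_{ij} a_{kl} = a_{kl} a_{ij}` if `(k-i)(k-j)(l-i)(l-j) > 0`, and
`a_{ij} a_{ik} = a_{jk} a_{ij} = a_{ik} a_{jk}` if `i < j < k`. -/
inductive BraidRel (n : ℕ) : FreeGroup (BandIndex n) → Prop
  | comm (i j k l : Fin n) (hij : i < j) (hkl : k < l)
      (h : 0 < ((k : ℤ) - (i : ℤ)) * ((k : ℤ) - (j : ℤ)) * ((l : ℤ) - (i : ℤ)) *
        ((l : ℤ) - (j : ℤ))) :
      BraidRel n ((bandLetter i j hij * bandLetter k l hkl) *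
        (bandLetter k l hkl * bandLetter i j hij)⁻¹)
  | triangle₁ (i j k : Fin n) (hij : i < j) (hjk : j < k) :
      BraidRel n ((bandLetter i j hij * bandLetter i k (hij.trans hjk)) *
        (bandLetter j k hjk * bandLetter i j hij)⁻¹)
  | triangle₂ (i j k : Fin n) (hij : i < j) (hjk : j < k) :
      BraidRel n ((bandLetter j k hjk * bandLetter i j hij) *
        (bandLetter i k (hij.trans hjk) * bandLetter j k hjk)⁻¹)

/-- The braid group `Br_n`, in its dual presentation. -/
abbrev BraidGroup (n : ℕ) : Type := PresentedGroup {r | BraidRel n r}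

/-- The band generator `a_{ij}` of `Br_n`. -/
def band {n : ℕ} (σ : BandIndex n) : BraidGroup n := PresentedGroup.of σ

/-- The power `b_{ij} = a_{ij} ^ m_{ij}` of a band generator. -/
def bandPow {n : ℕ} (M : Matrix (Fin n) (Fin n) ℕ) (σ : BandIndex n) : BraidGroup n :=
  band σ ^ M σ.1.1 σ.1.2

/-- The subgroup `E_M` of `Br_n` generated by all `a_{ij} ^ m_{ij}`, `i < j`. -/
def powerSubgroup {n : ℕ} (M : Matrix (Fin n) (Fin n) ℕ) : Subgroup (BraidGroup n) :=
  Subgroup.closure (Set.range (bandPow M))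

/-- `M` is of large type: no entry `m_{ij}`, `i < j`, is `1` or `2`. -/
def IsLargeType {n : ℕ} (M : Matrix (Fin n) (Fin n) ℕ) : Prop :=
  ∀ i j : Fin n, i < j → M i j ≠ 1 ∧ M i j ≠ 2

/-- The pairs `ij`, `i < j`, with `m_{ij} ≠ 0`. -/
abbrev BandSupport {n : ℕ} (M : Matrix (Fin n) (Fin n) ℕ) : Type :=
  {σ : BandIndex n // M σ.1.1 σ.1.2 ≠ 0}

/-- The relators `b_{ij} b_{kl} = b_{kl} b_{ij}`, for all pairs such that
`a_{ij} a_{kl} = a_{kl} a_{ij}` holds in `Br_n`. -/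
def commRels {n : ℕ} (M : Matrix (Fin n) (Fin n) ℕ) : Set (FreeGroup (BandSupport M)) :=
  {r | ∃ σ τ : BandSupport M, band σ.1 * band τ.1 = band τ.1 * band σ.1 ∧
    r = (FreeGroup.of σ * FreeGroup.of τ) * (FreeGroup.of τ * FreeGroup.of σ)⁻¹}

/-! Place the `n` strands on a circle, so that `a_{ij}` is a half-twist along the chord `ij`. Chords
that do not meet give commuting generators, so only injectivity of the map from the abstract group
to `Br_n` needs an argument. It is a ping-pong argument for right-angled Artin groups
(`eq_one_of_pingPong`), applied to the action of the braid group on the free group of the punctured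
disc.

The ping-pong set of `ij` is `spirals i j`: the reduced word contains three alternating letters
`x_i`, `x_j` of one sign. To see how a power of a half-twist changes a word, rewrite the word by
`chordHom`: a letter `s` records each crossing of the chord, and the loops around its two endpoints
become one letter `t`. In these letters the `k`-th power of the half-twist is the shear `s ↦ t^k
s^{±1} t^{-k}` (`exists_shear_of_halfTwist_zpow`). A shear never cancels letters other than `t`; it
only changes the powers of `t` between them.

If `pq` meets `ij`, a spiral around `pq` crosses `ij`. Then `|k| ≥ 3` produces a run of at least
three letters `t`, which reads back as a spiral around `ij` (`halfTwist_zpow_mem_spirals`). If the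
chords are disjoint, the spiral around `pq` stays on one side of `ij` and survives
(`halfTwist_zpow_mem_spirals_of_disjoint`). The length three is what large type supplies. It is also
what is needed: a chord sharing an endpoint with `pq` may separate `x_p` from `x_q` in only one of
the orders `x_p x_q`, `x_q x_p`, and three alternating letters contain both orders. -/

/-! ### Ping-pong for right-angled Artin groups. -/

section PingPong

variable {G Ω ι : Type*} [Group G]

/-- The product of a list of syllables `f σ ^ k`. -/
def syllableProd (f : ι → G) (l : List (ι × ℤ)) : G := (l.map fun p => f p.1 ^ p.2).prod

lemma syllableProd_cons (f : ι → G) (p : ι × ℤ) (l : List (ι × ℤ)) :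
    syllableProd f (p :: l) = f p.1 ^ p.2 * syllableProd f l := by
  simp [syllableProd]

/-- A syllable list is minimal if no shorter list has the same product. -/
def IsMinimalSyllables (f : ι → G) (l : List (ι × ℤ)) : Prop :=
  ∀ l', syllableProd f l' = syllableProd f l → l.length ≤ l'.length

lemma IsMinimalSyllables.tail {f : ι → G} {p : ι × ℤ} {l : List (ι × ℤ)}
    (h : IsMinimalSyllables f (p :: l)) : IsMinimalSyllables f l := fun l' hl' => by
  have := h (p :: l') (by rw [syllableProd_cons, syllableProd_cons, hl'])
  simpa using this

lemma IsMinimalSyllables.ne_zero {f : ι → G} {p : ι × ℤ} {l : List (ι × ℤ)}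
    (h : IsMinimalSyllables f (p :: l)) : p.2 ≠ 0 := fun h0 => by
  have := h l (by simp [syllableProd_cons, h0])
  simp at this

lemma IsMinimalSyllables.fst_ne {f : ι → G} {p q : ι × ℤ} {l : List (ι × ℤ)}
    (h : IsMinimalSyllables f (p :: q :: l)) : p.1 ≠ q.1 := fun h0 => by
  have := h ((p.1, p.2 + q.2) :: l)
    (by simp [syllableProd_cons, h0, zpow_add, mul_assoc])
  simp at this

lemma IsMinimalSyllables.swap {f : ι → G} {p q : ι × ℤ} {l : List (ι × ℤ)}
    (h : IsMinimalSyllables f (p :: q :: l)) (hc : Commute (f p.1) (f q.1)) :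
    IsMinimalSyllables f (q :: p :: l) := fun l' hl' => by
  have := h l' (by
    rw [hl']
    simp only [syllableProd_cons, ← mul_assoc]
    rw [(hc.zpow_zpow p.2 q.2).eq])
  simpa using this

lemma exists_minimal_syllables (f : ι → G) (hgen : Subgroup.closure (Set.range f) = ⊤) (g : G) :
    ∃ l, syllableProd f l = g ∧ IsMinimalSyllables f l := by
  have hex : ∃ l, syllableProd f l = g := by
    have hg : g ∈ Subgroup.closure (Set.range f) := hgen ▸ Subgroup.mem_top g
    induction hg using Subgroup.closure_induction_left with
    | one => exact ⟨[], by simp [syllableProd]⟩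
    | mul_left x hx y _ ih =>
      obtain ⟨σ, rfl⟩ := hx
      obtain ⟨l, rfl⟩ := ih
      exact ⟨(σ, 1) :: l, by simp [syllableProd_cons]⟩
    | inv_mul_cancel x hx y _ ih =>
      obtain ⟨σ, rfl⟩ := hx
      obtain ⟨l, rfl⟩ := ih
      exact ⟨(σ, -1) :: l, by simp [syllableProd_cons]⟩
  classical
  have hlen : ∃ n, ∃ l, syllableProd f l = g ∧ l.length = n := by
    obtain ⟨l, hl⟩ := hex
    exact ⟨_, l, hl, rfl⟩
  obtain ⟨l, hl, hn⟩ := Nat.find_spec hlen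
  exact ⟨l, hl, fun l' hl' => hn ▸ Nat.find_min' hlen ⟨l', hl'.trans hl, rfl⟩⟩

variable [MulAction G Ω]

/-- Induction on the number of syllables. If the first two syllables are related by `C`, they are
exchanged: the shorter word without the second syllable already moves a base point into the set of
the first, and the second syllable preserves that set. Otherwise the second syllable brings the
point into its own set, and the first one plays ping-pong; minimality makes the two generators
distinct. -/
lemma IsMinimalSyllables.exists_smul_mem {f : ι → G} {C : ι → ι → Prop}
    (hC : ∀ σ τ, C σ τ → Commute (f σ) (f τ)) {X : ι → Set Ω} {Y : Set Ω}
    (hmeet : ∀ σ τ, σ ≠ τ → ¬ C σ τ → ∀ k : ℤ, k ≠ 0 → ∀ x ∈ X τ, f σ ^ k • x ∈ X σ)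
    (hdisj : ∀ σ τ, C σ τ → ∀ k : ℤ, k ≠ 0 → ∀ x ∈ X τ, f σ ^ k • x ∈ X τ)
    (hsymm : ∀ σ τ, C σ τ → C τ σ)
    (hbase : ∀ σ, ∀ k : ℤ, k ≠ 0 → ∃ y ∈ Y, f σ ^ k • y ∈ X σ)
    (l : List (ι × ℤ)) (p : ι × ℤ) (h : IsMinimalSyllables f (p :: l)) :
    ∃ y ∈ Y, syllableProd f (p :: l) • y ∈ X p.1 := by
  induction l generalizing p with
  | nil =>
    obtain ⟨y, hy, hyX⟩ := hbase p.1 p.2 h.ne_zero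
    exact ⟨y, hy, by simpa [syllableProd] using hyX⟩
  | cons q l ih =>
    by_cases hpq : C p.1 q.1
    · have hs := h.swap (hC _ _ hpq)
      obtain ⟨y, hy, hyX⟩ := ih p hs.tail
      refine ⟨y, hy, ?_⟩
      have := hdisj q.1 p.1 (hsymm _ _ hpq) q.2 hs.ne_zero _ hyX
      rwa [smul_smul, syllableProd_cons, ← mul_assoc,
        ← ((hC _ _ hpq).zpow_zpow p.2 q.2).eq, mul_assoc, ← syllableProd_cons,
        ← syllableProd_cons] at this
    · obtain ⟨y, hy, hyX⟩ := ih q h.tail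
      refine ⟨y, hy, ?_⟩
      rw [syllableProd_cons, mul_smul]
      exact hmeet _ _ h.fst_ne hpq _ h.ne_zero _ hyX

/-- Ping-pong for right-angled Artin groups: an action for which the powers of the generators
play ping-pong, up to the commutations prescribed by `C`, is faithful. -/
theorem eq_one_of_pingPong (f : ι → G) (hgen : Subgroup.closure (Set.range f) = ⊤)
    (C : ι → ι → Prop) (hC : ∀ σ τ, C σ τ → Commute (f σ) (f τ)) (X : ι → Set Ω) (Y : Set Ω)
    (hmeet : ∀ σ τ, σ ≠ τ → ¬ C σ τ → ∀ k : ℤ, k ≠ 0 → ∀ x ∈ X τ, f σ ^ k • x ∈ X σ)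
    (hdisj : ∀ σ τ, C σ τ → ∀ k : ℤ, k ≠ 0 → ∀ x ∈ X τ, f σ ^ k • x ∈ X τ)
    (hsymm : ∀ σ τ, C σ τ → C τ σ)
    (hbase : ∀ σ, ∀ k : ℤ, k ≠ 0 → ∃ y ∈ Y, f σ ^ k • y ∈ X σ)
    (hY : ∀ σ, ∀ y ∈ Y, y ∉ X σ) {g : G} (hg : ∀ x : Ω, g • x = x) : g = 1 := by
  obtain ⟨l, rfl, hl⟩ := exists_minimal_syllables f hgen g
  cases l with
  | nil => simp [syllableProd]
  | cons p l =>
    obtain ⟨y, hy, hyX⟩ := hl.exists_smul_mem hC hmeet hdisj hsymm hbase l p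
    rw [hg] at hyX
    exact absurd hyX (hY _ _ hy)

end PingPong

/-! ### Half-twists of the free group and the braid action. -/

section HalfTwist

set_option linter.unusedSimpArgs false

variable {n : ℕ}

/-- The side of the chord `ij` on which the loop `x_k` starts:
`true` for the side of the points strictly between `i` and `j`. -/
def sideBefore (i j k : Fin n) : Bool := decide (i < k ∧ k ≤ j)

/-- The side of the chord `ij` on which the loop `x_k` ends. -/
def sideAfter (i j k : Fin n) : Bool := decide (i ≤ k ∧ k < j)

/-- The endomorphism of the free group twisting each crossing of the chord `ij` by `v`. -/
def crossTwist (i j : Fin n) (v : FreeGroup (Fin n)) : FreeGroup (Fin n) →* FreeGroup (Fin n) :=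
  FreeGroup.lift fun k =>
    (if sideBefore i j k then v else 1)⁻¹ * FreeGroup.of k * (if sideAfter i j k then v else 1)

lemma crossTwist_of (i j : Fin n) (v : FreeGroup (Fin n)) (k : Fin n) :
    crossTwist i j v (FreeGroup.of k) =
      (if sideBefore i j k then v else 1)⁻¹ * FreeGroup.of k *
        (if sideAfter i j k then v else 1) := by
  simp [crossTwist]

lemma crossTwist_left {i j : Fin n} (h : i < j) (v : FreeGroup (Fin n)) :
    crossTwist i j v (FreeGroup.of i) = FreeGroup.of i * v := by
  simp [crossTwist_of, sideBefore, sideAfter, h]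

lemma crossTwist_right {i j : Fin n} (h : i < j) (v : FreeGroup (Fin n)) :
    crossTwist i j v (FreeGroup.of j) = v⁻¹ * FreeGroup.of j := by
  simp [crossTwist_of, sideBefore, sideAfter, h]

lemma crossTwist_between {i j k : Fin n} (h : i < k) (h' : k < j) (v : FreeGroup (Fin n)) :
    crossTwist i j v (FreeGroup.of k) = v⁻¹ * FreeGroup.of k * v := by
  simp [crossTwist_of, sideBefore, sideAfter, h, h', h.le, h'.le]

lemma crossTwist_lt {i j k : Fin n} (h : k < i) (v : FreeGroup (Fin n)) :
    crossTwist i j v (FreeGroup.of k) = FreeGroup.of k := by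
  simp [crossTwist_of, sideBefore, sideAfter, h, h.not_gt, h.not_ge]

lemma crossTwist_gt {i j k : Fin n} (h : j < k) (v : FreeGroup (Fin n)) :
    crossTwist i j v (FreeGroup.of k) = FreeGroup.of k := by
  simp [crossTwist_of, sideBefore, sideAfter, h, h.not_gt, h.not_ge]

/-- The hypothesis says that the outer twist sends `v'` to `v⁻¹`, which cancels the factors it
inserts itself. -/
lemma crossTwist_comp {i j : Fin n} {v v' : FreeGroup (Fin n)}
    (h : v * crossTwist i j v v' = 1) :
    (crossTwist i j v).comp (crossTwist i j v') = MonoidHom.id _ := by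
  ext k
  have h' : (crossTwist i j v v') = v⁻¹ := eq_inv_of_mul_eq_one_right h
  simp only [MonoidHom.comp_apply, MonoidHom.id_apply]
  rw [crossTwist_of i j v' k]
  cases hb : sideBefore i j k <;> cases ha : sideAfter i j k <;>
    simp [h', crossTwist_of, hb, ha, mul_assoc]

/-- The half-twist of the free group along the chord `ij`. -/
def halfTwist {i j : Fin n} (h : i < j) : MulAut (FreeGroup (Fin n)) :=
  -- This twisting element gives `x_j ↦ x_i` and `x_i ↦ x_i x_j x_i⁻¹`.
  MonoidHom.toMulEquiv (crossTwist i j (FreeGroup.of j * (FreeGroup.of i)⁻¹))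
    (crossTwist i j ((FreeGroup.of i)⁻¹ * FreeGroup.of j))
    (crossTwist_comp (by simp [crossTwist_left h, crossTwist_right h]))
    (crossTwist_comp (by simp [crossTwist_left h, crossTwist_right h, mul_assoc]))

lemma halfTwist_apply {i j : Fin n} (h : i < j) (w : FreeGroup (Fin n)) :
    halfTwist h w = crossTwist i j (FreeGroup.of j * (FreeGroup.of i)⁻¹) w := rfl

lemma mulAut_ext_of {f g : MulAut (FreeGroup (Fin n))}
    (h : ∀ k, f (FreeGroup.of k) = g (FreeGroup.of k)) : f = g := by
  have : f.toMonoidHom = g.toMonoidHom := FreeGroup.ext_hom _ _ h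
  exact MulEquiv.ext fun x => DFunLike.congr_fun this x

/-- Half-twists satisfy the triangle relations with the factors in reverse order, which is why the
braid generators act by their inverses. -/
lemma halfTwist_triangle₁ {i j k : Fin n} (hij : i < j) (hjk : j < k) :
    halfTwist (hij.trans hjk) * halfTwist hij = halfTwist hij * halfTwist hjk := by
  have hik := hij.trans hjk
  refine mulAut_ext_of fun l => ?_
  simp only [MulAut.mul_apply, halfTwist_apply]
  rcases lt_trichotomy l i with h | rfl | h
  · simp [crossTwist_lt, h, h.trans hij]
  · simp [crossTwist_lt, crossTwist_left, crossTwist_between, hij, hjk, hik, mul_assoc]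
  rcases lt_trichotomy l j with h2 | rfl | h2
  · simp [crossTwist_lt, crossTwist_left, crossTwist_between, hij, hjk, hik, h, h2, h2.trans hjk,
      mul_assoc]
  · simp [crossTwist_lt, crossTwist_gt, crossTwist_left, crossTwist_right, crossTwist_between,
      hij, hjk, hik, mul_assoc]
  rcases lt_trichotomy l k with h3 | rfl | h3
  · simp [crossTwist_lt, crossTwist_gt, crossTwist_left, crossTwist_right, crossTwist_between,
      hij, hjk, hik, h, h2, h3, mul_assoc]
  · simp [crossTwist_lt, crossTwist_gt, crossTwist_left, crossTwist_right, crossTwist_between,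
      hij, hjk, hik, mul_assoc]
  · simp [crossTwist_gt, h2, h3]

lemma halfTwist_triangle₂ {i j k : Fin n} (hij : i < j) (hjk : j < k) :
    halfTwist hij * halfTwist hjk = halfTwist hjk * halfTwist (hij.trans hjk) := by
  have hik := hij.trans hjk
  refine mulAut_ext_of fun l => ?_
  simp only [MulAut.mul_apply, halfTwist_apply]
  rcases lt_trichotomy l i with h | rfl | h
  · simp [crossTwist_lt, h, h.trans hij]
  · simp [crossTwist_lt, crossTwist_left, crossTwist_right, hij, hjk, hik, mul_assoc]
  rcases lt_trichotomy l j with h2 | rfl | h2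
  · simp [crossTwist_lt, crossTwist_left, crossTwist_right, crossTwist_between, hij, hjk, hik, h,
      h2, h2.trans hjk, mul_assoc]
  · simp [crossTwist_lt, crossTwist_gt, crossTwist_left, crossTwist_right, crossTwist_between,
      hij, hjk, hik, mul_assoc]
  rcases lt_trichotomy l k with h3 | rfl | h3
  · simp [crossTwist_lt, crossTwist_gt, crossTwist_left, crossTwist_right, crossTwist_between,
      hij, hjk, hik, h, h2, h3, mul_assoc]
  · simp [crossTwist_lt, crossTwist_gt, crossTwist_left, crossTwist_right, crossTwist_between,
      hij, hjk, hik, mul_assoc]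
  · simp [crossTwist_gt, h2, h3]

lemma commute_halfTwist_of_lt {i j k l : Fin n} (hij : i < j) (hkl : k < l) (hjk : j < k) :
    Commute (halfTwist hij) (halfTwist hkl) := by
  refine mulAut_ext_of fun m => ?_
  simp only [MulAut.mul_apply, halfTwist_apply]
  rcases lt_or_ge j m with h | h
  · rw [crossTwist_gt h]
    rcases lt_trichotomy m k with h2 | rfl | h2
    · simp [crossTwist_lt, crossTwist_gt, h, h2]
    · simp [crossTwist_left, crossTwist_gt, h, hkl, hjk.trans hkl]
    rcases lt_trichotomy m l with h3 | rfl | h3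
    · simp [crossTwist_between, crossTwist_gt, h, h2, h3, hkl, hjk, hjk.trans hkl]
    · simp [crossTwist_right, crossTwist_gt, h, hkl, hjk, hjk.trans hkl]
    · simp [crossTwist_gt, h, h3]
  · rw [crossTwist_lt (h.trans_lt hjk)]
    rcases lt_trichotomy m i with h2 | rfl | h2
    · simp [crossTwist_lt, h.trans_lt hjk, h2]
    · simp [crossTwist_left, crossTwist_lt, hij, hjk, hij.trans hjk]
    rcases h.lt_or_eq with h3 | rfl
    · simp [crossTwist_between, crossTwist_lt, h2, h3, hij, hjk, hij.trans hjk, h3.trans hjk]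
    · simp [crossTwist_right, crossTwist_lt, hij, hjk, hij.trans hjk]

lemma commute_halfTwist_of_nested {i j k l : Fin n} (hij : i < j) (hik : i < k) (hkl : k < l)
    (hlj : l < j) : Commute (halfTwist hij) (halfTwist hkl) := by
  have hkj := hkl.trans hlj
  have hil := hik.trans hkl
  refine mulAut_ext_of fun m => ?_
  simp only [MulAut.mul_apply, halfTwist_apply]
  rcases lt_trichotomy m i with h | rfl | h
  · simp [crossTwist_lt, h, h.trans hik]
  · simp [crossTwist_lt, crossTwist_left, crossTwist_gt, hik, hij, hlj]
  rcases lt_trichotomy m j with h2 | rfl | h2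
  · rcases lt_trichotomy m k with h3 | rfl | h3
    · simp [crossTwist_between, crossTwist_lt, crossTwist_gt, hik, hlj, h, h2, h3]
    · simp [crossTwist_between, crossTwist_lt, crossTwist_left, crossTwist_gt, hik, hkl, hlj, hkj,
        hil, mul_assoc]
    rcases lt_trichotomy m l with h4 | rfl | h4
    · simp [crossTwist_between, crossTwist_lt, crossTwist_left, crossTwist_gt, hik, hkl, hlj, hkj,
        hil, h, h2, h3, h4, mul_assoc]
    · simp [crossTwist_between, crossTwist_lt, crossTwist_right, crossTwist_gt, hik, hkl, hlj, hkj,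
        hil, mul_assoc]
    · simp [crossTwist_between, crossTwist_lt, crossTwist_gt, hik, hlj, h, h2, h4]
  · simp [crossTwist_lt, crossTwist_right, crossTwist_gt, hik, hij, hlj]
  · simp [crossTwist_gt, h2, hlj.trans h2]

/-- The chords `ij` and `kl` (with `i < j` and `k < l`) do not meet, not even in an endpoint. -/
def ChordsDisjoint (i j k l : Fin n) : Prop :=
  j < k ∨ l < i ∨ (i < k ∧ l < j) ∨ (k < i ∧ j < l)

/-- The product is positive exactly when `k` and `l` lie in the same open arc cut out by `i` and
`j`. -/
lemma chordsDisjoint_iff {i j k l : Fin n} (hij : i < j) (hkl : k < l) :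
    ChordsDisjoint i j k l ↔
      0 < ((k : ℤ) - (i : ℤ)) * ((k : ℤ) - (j : ℤ)) * ((l : ℤ) - (i : ℤ)) *
        ((l : ℤ) - (j : ℤ)) := by
  have key : ∀ a b c d : ℤ, a < b → c < d → ((b < c ∨ d < a ∨ (a < c ∧ d < b) ∨ (c < a ∧ b < d)) ↔
      0 < (c - a) * (c - b) * (d - a) * (d - b)) := by
    intro a b c d hab hcd
    constructor
    · rintro (h | h | ⟨h, h'⟩ | ⟨h, h'⟩)
      · have h1 : 0 < c - a := by linarith
        have h2 : 0 < c - b := by linarith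
        have h3 : 0 < d - a := by linarith
        have h4 : 0 < d - b := by linarith
        positivity
      · have h1 : 0 < a - c := by linarith
        have h2 : 0 < b - c := by linarith
        have h3 : 0 < a - d := by linarith
        have h4 : 0 < b - d := by linarith
        have : 0 < (a - c) * (b - c) * (a - d) * (b - d) := by positivity
        linarith
      · have h1 : 0 < c - a := by linarith
        have h2 : 0 < b - c := by linarith
        have h3 : 0 < d - a := by linarith
        have h4 : 0 < b - d := by linarith
        have : 0 < (c - a) * (b - c) * (d - a) * (b - d) := by positivity
        linarith
      · have h1 : 0 < a - c := by linarith
        have h2 : 0 < b - c := by linarith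
        have h3 : 0 < d - a := by linarith
        have h4 : 0 < d - b := by linarith
        have : 0 < (a - c) * (b - c) * (d - a) * (d - b) := by positivity
        linarith
    · intro hpos
      by_contra hcon
      push Not at hcon
      obtain ⟨h1, h2, h3, h4⟩ := hcon
      rcases lt_or_ge a c with h | h
      · have h5 := h3 h
        have e1 : 0 ≤ c - a := by linarith
        have e2 : 0 ≤ b - c := by linarith
        have e3 : 0 ≤ d - a := by linarith
        have e4 : 0 ≤ d - b := by linarith
        have : 0 ≤ (c - a) * (b - c) * (d - a) * (d - b) := by positivity
        linarith
      · rcases h.lt_or_eq with h | rfl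
        · have h5 := h4 h
          have e1 : 0 ≤ a - c := by linarith
          have e2 : 0 ≤ b - c := by linarith
          have e3 : 0 ≤ d - a := by linarith
          have e4 : 0 ≤ b - d := by linarith
          have : 0 ≤ (a - c) * (b - c) * (d - a) * (b - d) := by positivity
          linarith
        · simp at hpos
  rw [← key _ _ _ _ (by exact_mod_cast hij) (by exact_mod_cast hkl)]
  simp only [ChordsDisjoint, Fin.lt_def, Nat.cast_lt]

lemma ChordsDisjoint.commute_halfTwist {i j k l : Fin n} (hij : i < j) (hkl : k < l)
    (h : ChordsDisjoint i j k l) : Commute (halfTwist hij) (halfTwist hkl) := by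
  rcases h with h | h | ⟨h, h'⟩ | ⟨h, h'⟩
  · exact commute_halfTwist_of_lt hij hkl h
  · exact (commute_halfTwist_of_lt hkl hij h).symm
  · exact commute_halfTwist_of_nested hij h hkl h'
  · exact (commute_halfTwist_of_nested hkl h hij h').symm

/-- The action of the braid group on the free group by inverse half-twists. -/
def braidAction (n : ℕ) : BraidGroup n →* MulAut (FreeGroup (Fin n)) :=
  PresentedGroup.toGroup (f := fun σ : BandIndex n => (halfTwist σ.2)⁻¹) (by
    rintro r (⟨i, j, k, l, hij, hkl, h⟩ | ⟨i, j, k, hij, hjk⟩ | ⟨i, j, k, hij, hjk⟩)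
    · have := ((chordsDisjoint_iff hij hkl).2 h).commute_halfTwist hij hkl
      simp only [map_mul, map_inv, FreeGroup.lift_apply_of]
      rw [mul_inv_eq_one]
      exact this.inv_inv
    · simp only [map_mul, map_inv, FreeGroup.lift_apply_of]
      rw [mul_inv_eq_one, ← mul_inv_rev, ← mul_inv_rev, halfTwist_triangle₁]
    · simp only [map_mul, map_inv, FreeGroup.lift_apply_of]
      rw [mul_inv_eq_one, ← mul_inv_rev, ← mul_inv_rev, halfTwist_triangle₂])

lemma braidAction_band (σ : BandIndex n) : braidAction n (band σ) = (halfTwist σ.2)⁻¹ := by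
  simp [braidAction, band]

lemma ChordsDisjoint.commute_band {σ τ : BandIndex n}
    (h : ChordsDisjoint σ.1.1 σ.1.2 τ.1.1 τ.1.2) : Commute (band σ) (band τ) := by
  have hr := BraidRel.comm σ.1.1 σ.1.2 τ.1.1 τ.1.2 σ.2 τ.2 ((chordsDisjoint_iff σ.2 τ.2).1 h)
  have := PresentedGroup.one_of_mem (rels := {r | BraidRel n r}) hr
  rw [map_mul, map_inv, mul_inv_eq_one] at this
  exact this

end HalfTwist

/-! ### Shears and reduced words. -/

section Shear

variable {β : Type*}

lemma mk_singleton_false (x : β) : FreeGroup.mk [(x, false)] = (FreeGroup.of x)⁻¹ := by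
  simp [FreeGroup.of, FreeGroup.inv_mk, FreeGroup.invRev]

/-- The reduced word of `t ^ r`. -/
def runWord (t : β) (r : ℤ) : List (β × Bool) := List.replicate r.natAbs (t, decide (0 < r))

lemma mk_runWord (t : β) (r : ℤ) : FreeGroup.mk (runWord t r) = FreeGroup.of t ^ r := by
  rcases lt_trichotomy r 0 with h | rfl | h
  · obtain ⟨m, rfl⟩ := Int.eq_ofNat_of_zero_le (neg_nonneg.2 h.le) |>.imp fun m hm => by
      exact (neg_eq_iff_eq_neg.1 hm)
    rw [runWord, decide_eq_false h.not_gt, zpow_neg, ← inv_zpow, ← mk_singleton_false, zpow_natCast,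
      FreeGroup.pow_mk, List.flatten_replicate_singleton]
    simp
  · simp [runWord, FreeGroup.one_eq_mk]
  · obtain ⟨m, rfl⟩ := Int.eq_ofNat_of_zero_le h.le
    rw [runWord, decide_eq_true h, zpow_natCast, FreeGroup.of, FreeGroup.pow_mk,
      List.flatten_replicate_singleton]
    simp

lemma isReduced_runWord (t : β) (r : ℤ) : FreeGroup.IsReduced (runWord t r) :=
  List.isChain_replicate_of_rel _ fun _ => rfl

lemma fst_of_mem_runWord {t : β} {r : ℤ} {z : β × Bool} (h : z ∈ runWord t r) : z.1 = t := by
  rw [List.eq_of_mem_replicate h]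

lemma replicate_three_infix_runWord (t : β) {r : ℤ} (h : 3 ≤ |r|) :
    ∃ b, [(t, b), (t, b), (t, b)] <:+: runWord t r := by
  refine ⟨decide (0 < r), [], List.replicate (r.natAbs - 3) (t, decide (0 < r)), ?_⟩
  have h3 : 3 ≤ r.natAbs := by rw [Int.abs_eq_natAbs] at h; omega
  rw [List.nil_append, runWord]
  conv_rhs => rw [show r.natAbs = 3 + (r.natAbs - 3) by omega, List.replicate_add]
  rfl

variable [DecidableEq β]

/-- The endomorphism sending `s` to `t ^ k * s ^ (±1) * t ^ (-k)` and fixing the other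
generators; the exponent of `s` is `1` if `c` and `-1` otherwise. -/
def shear (s t : β) (k : ℤ) (c : Bool) : FreeGroup β →* FreeGroup β :=
  FreeGroup.lift fun x =>
    if x = s then FreeGroup.of t ^ k * FreeGroup.mk [(s, c)] * FreeGroup.of t ^ (-k)
    else FreeGroup.of x

/-- The effect of `shear s t k c` on letters other than `t`, up to powers of `t`. -/
def shearLetter (s : β) (c : Bool) (z : β × Bool) : β × Bool :=
  if z.1 = s then (s, z.2 == c) else z

/-- The power of `t` which `shear s t k c` puts in front of a letter. -/
def shearShift (s : β) (k : ℤ) (z : β × Bool) : ℤ := if z.1 = s then k else 0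

lemma shearLetter_fst (s : β) (c : Bool) (z : β × Bool) : (shearLetter s c z).1 = z.1 := by
  unfold shearLetter; split_ifs with h <;> simp [h]

lemma shearLetter_snd_eq {s : β} {c : Bool} {y z : β × Bool} (h1 : y.1 = z.1)
    (h : y.2 = z.2) : (shearLetter s c y).2 = (shearLetter s c z).2 := by
  rw [Prod.ext h1 h]

lemma shear_of_ne {s t x : β} (k : ℤ) (c : Bool) (h : x ≠ s) :
    shear s t k c (FreeGroup.of x) = FreeGroup.of x := by
  simp [shear, h]

lemma shear_of_self (s t : β) (k : ℤ) (c : Bool) :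
    shear s t k c (FreeGroup.of s) =
      FreeGroup.of t ^ k * FreeGroup.mk [(s, c)] * FreeGroup.of t ^ (-k) := by
  simp [shear]

lemma shear_mk_singleton (s t : β) (k : ℤ) (c : Bool) (z : β × Bool) :
    shear s t k c (FreeGroup.mk [z]) =
      FreeGroup.of t ^ shearShift s k z * FreeGroup.mk [shearLetter s c z] *
        FreeGroup.of t ^ (-shearShift s k z) := by
  obtain ⟨x, b⟩ := z
  by_cases h : x = s
  · subst h
    cases b
    · rw [mk_singleton_false, map_inv, shear_of_self]
      simp [shearShift, shearLetter, FreeGroup.inv_mk, FreeGroup.invRev, mul_assoc]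
    · change shear x t k c (FreeGroup.of x) = _
      rw [shear_of_self]
      simp [shearShift, shearLetter]
  · cases b
    · rw [mk_singleton_false, map_inv, shear_of_ne k c h]
      simp [shearShift, shearLetter, h, mk_singleton_false]
    · change shear s t k c (FreeGroup.of x) = _
      rw [shear_of_ne k c h]
      simp [shearShift, shearLetter, h, FreeGroup.of]

/-- `ShearState s t k c g h o r` records how far the reduced image of the word `g` under
`shear s t k c` is known: `g` ends in `t ^ r`, preceded by the letter `o` (if any), and its image
is the reduced word `h`, which ends in the image of `o`, followed by a power of `t`. -/
structure ShearState (s t : β) (k : ℤ) (c : Bool) (g h : List (β × Bool))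
    (o : Option (β × Bool)) (r : ℤ) : Prop where
  last : g.getLast? = if r = 0 then o else some (t, decide (0 < r))
  ne : ∀ z ∈ o, z.1 ≠ t
  lastImage : h.getLast? = o.map (shearLetter s c)
  isReduced : FreeGroup.IsReduced h
  image : shear s t k c (FreeGroup.mk g) =
    FreeGroup.mk h * FreeGroup.of t ^ (r - o.elim 0 (shearShift s k))

namespace ShearState

variable {s t : β} {k : ℤ} {c : Bool} {g h : List (β × Bool)} {o : Option (β × Bool)} {r : ℤ}

lemma nil : ShearState s t k c [] [] none 0 where
  last := by simp
  ne := by simp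
  lastImage := by simp
  isReduced := FreeGroup.IsReduced.nil
  image := by simp [← FreeGroup.one_eq_mk]

lemma isReduced_append_runWord (S : ShearState s t k c g h o r) (e : ℤ) :
    FreeGroup.IsReduced (h ++ runWord t e) := by
  refine List.isChain_append.2 ⟨S.isReduced, isReduced_runWord t e, ?_⟩
  intro x hx y hy hxy
  rw [S.lastImage] at hx
  obtain ⟨z, hz, rfl⟩ := Option.mem_map.1 hx
  rw [shearLetter_fst, fst_of_mem_runWord (List.mem_of_mem_head? hy)] at hxy
  exact absurd hxy (S.ne z hz)

lemma toWord_image (S : ShearState s t k c g h o r) :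
    (shear s t k c (FreeGroup.mk g)).toWord =
      h ++ runWord t (r - o.elim 0 (shearShift s k)) := by
  rw [S.image, ← mk_runWord, FreeGroup.mul_mk, FreeGroup.toWord_mk,
    (S.isReduced_append_runWord _).reduce_eq]

/-- Since the word is reduced, the new letter has the sign of the current run of `t`, so the run
grows in absolute value and the exponent is never cancelled back to zero. -/
lemma append_t (S : ShearState s t k c g h o r) (ht : s ≠ t) {b : Bool}
    (hr : FreeGroup.IsReduced (g ++ [(t, b)])) :
    ShearState s t k c (g ++ [(t, b)]) h o (r + if b then 1 else -1) := by
  have hlast : ∀ z ∈ g.getLast?, z.1 = t → z.2 = b := fun z hz h1 =>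
    (List.isChain_append.1 hr).2.2 z hz (t, b) (by simp) h1
  rw [S.last] at hlast
  refine ⟨?_, S.ne, S.lastImage, S.isReduced, ?_⟩
  · rw [List.getLast?_append]
    rcases lt_trichotomy r 0 with h | rfl | h
    · have := hlast (t, false) (by simp [h.ne, h.le]) rfl
      subst this
      have h2 : r + -1 ≠ 0 := by omega
      have h3 : ¬ 0 < r + -1 := by omega
      simp [h2, h3]
    · cases b <;> simp
    · have := hlast (t, true) (by simp [h.ne', h]) rfl
      subst this
      have h2 : r + 1 ≠ 0 := by omega
      have h3 : 0 < r + 1 := by omega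
      simp [h2, h3]
  · rw [← FreeGroup.mul_mk, map_mul, S.image, mul_assoc]
    have : shear s t k c (FreeGroup.mk [(t, b)]) = FreeGroup.of t ^ (if b then (1 : ℤ) else -1) := by
      cases b
      · rw [mk_singleton_false, map_inv, shear_of_ne k c ht.symm]; simp
      · change shear s t k c (FreeGroup.of t) = _
        rw [shear_of_ne k c ht.symm]; simp
    rw [this, ← zpow_add]
    congr 2
    ring

/-- Letters other than `t` do not cancel. If the power of `t` between the images of two such letters
with the same name vanishes, their shifts agree, so `r = 0`: the letters were already adjacent,
hence of equal sign, and the shear changes both signs alike. -/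
lemma append_ne (S : ShearState s t k c g h o r) {z : β × Bool} (hz : z.1 ≠ t)
    (hr : FreeGroup.IsReduced (g ++ [z])) :
    ShearState s t k c (g ++ [z])
      (h ++ runWord t (r - o.elim 0 (shearShift s k) + shearShift s k z) ++ [shearLetter s c z])
      (some z) 0 := by
  have hlast : ∀ y ∈ g.getLast?, y.1 = z.1 → y.2 = z.2 := fun y hy h1 =>
    (List.isChain_append.1 hr).2.2 y hy z (by simp) h1
  rw [S.last] at hlast
  refine ⟨by simp, by simpa using hz, by simp, ?_, ?_⟩
  · refine List.isChain_append.2 ⟨S.isReduced_append_runWord _, List.isChain_singleton _, ?_⟩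
    intro x hx y hy hxy
    have hy' : shearLetter s c z = y := by simpa using hy
    subst hy'
    rw [shearLetter_fst] at hxy
    by_cases he : runWord t (r - o.elim 0 (shearShift s k) + shearShift s k z) = []
    · rw [he, List.append_nil, S.lastImage] at hx
      obtain ⟨y, hy, rfl⟩ := Option.mem_map.1 hx
      rw [shearLetter_fst] at hxy
      refine shearLetter_snd_eq hxy (hlast y ?_ hxy)
      have hoy : o = some y := hy
      have hr0 : r = 0 := by
        simp only [runWord, List.replicate_eq_nil_iff, Int.natAbs_eq_zero, hoy, Option.elim,
          shearShift, hxy] at he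
        omega
      rw [if_pos hr0]
      exact hy
    · rw [List.getLast?_append_of_ne_nil _ he] at hx
      rw [fst_of_mem_runWord (List.mem_of_mem_getLast? hx)] at hxy
      exact absurd hxy.symm hz
  · rw [← FreeGroup.mul_mk, map_mul, S.image, shear_mk_singleton, ← FreeGroup.mul_mk,
      ← FreeGroup.mul_mk, mk_runWord, zpow_add]
    simp [mul_assoc]

lemma extend (S : ShearState s t k c g h o r) (ht : s ≠ t) (g' : List (β × Bool))
    (hr : FreeGroup.IsReduced (g ++ g')) :
    ∃ h' o' r', ShearState s t k c (g ++ g') h' o' r' ∧ h <+: h' := by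
  induction g' generalizing g h o r with
  | nil => exact ⟨h, o, r, by simpa using S, List.prefix_refl h⟩
  | cons z g' ih =>
    have hr' : FreeGroup.IsReduced (g ++ [z] ++ g') := by simpa using hr
    have hr1 : FreeGroup.IsReduced (g ++ [z]) := hr'.infix (List.prefix_append _ _).isInfix
    rw [show g ++ z :: g' = g ++ [z] ++ g' by simp]
    by_cases hz : z.1 = t
    · obtain ⟨x, b⟩ := z
      obtain rfl : x = t := hz
      exact ih (S.append_t ht hr1) hr'
    · obtain ⟨h', o', r', S', hp⟩ := ih (S.append_ne hz hr1) hr'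
      refine ⟨h', o', r', S', List.IsPrefix.trans ?_ hp⟩
      rw [List.append_assoc]
      exact List.prefix_append _ _

/-- The recorded part of the image is final: later letters only extend it. -/
lemma infix_of_append (S : ShearState s t k c g h o r) (ht : s ≠ t) {g' : List (β × Bool)}
    (hr : FreeGroup.IsReduced (g ++ g')) {l : List (β × Bool)} (hl : l <:+: h) :
    l <:+: (shear s t k c (FreeGroup.mk (g ++ g'))).toWord := by
  obtain ⟨h', o', r', S', hp⟩ := S.extend ht g' hr
  rw [S'.toWord_image]
  exact (hl.trans hp.isInfix).trans (List.prefix_append _ _).isInfix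

end ShearState

variable {s t : β} {k : ℤ} {c : Bool}

lemma exists_shearState_append (ht : s ≠ t) {g : List (β × Bool)} {z : β × Bool} (hz : z.1 ≠ t)
    (hr : FreeGroup.IsReduced (g ++ [z])) :
    ∃ h, ShearState s t k c (g ++ [z]) (h ++ [shearLetter s c z]) (some z) 0 := by
  obtain ⟨h, o, r, S, -⟩ := (ShearState.nil (s := s) (t := t) (k := k) (c := c)).extend ht g
    (hr.infix (List.prefix_append _ _).isInfix)
  exact ⟨_, S.append_ne hz (by simpa using hr)⟩

/-- With no `t` between `y` and `z`, the run in the image comes only from the power put behind `y`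
and the power put in front of `z`. -/
lemma runWord_infix_shear (ht : s ≠ t) {L : List (β × Bool)} (hr : FreeGroup.IsReduced L)
    {y z : β × Bool} (hy : y.1 ≠ t) (hz : z.1 ≠ t) (hL : [y, z] <:+: L) :
    runWord t (shearShift s k z - shearShift s k y) <:+:
      (shear s t k c (FreeGroup.mk L)).toWord := by
  obtain ⟨g, g', rfl⟩ := hL
  have e : g ++ [y, z] ++ g' = (g ++ [y]) ++ [z] ++ g' := by simp
  rw [e] at hr ⊢
  have hr1 : FreeGroup.IsReduced (g ++ [y] ++ [z]) := hr.infix (List.prefix_append _ _).isInfix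
  obtain ⟨h, S⟩ := exists_shearState_append (k := k) (c := c) ht hy
    (hr1.infix (List.prefix_append _ _).isInfix)
  refine (S.append_ne hz hr1).infix_of_append ht hr ?_
  simp only [Option.elim]
  rw [show (0 : ℤ) - shearShift s k y + shearShift s k z = shearShift s k z - shearShift s k y by
    ring]
  exact List.infix_append _ _ _

lemma triple_infix_shear (ht : s ≠ t) {L : List (β × Bool)} (hr : FreeGroup.IsReduced L)
    {x y z : β × Bool} (hx : x.1 ≠ t) (hy : y.1 ≠ t) (hz : z.1 ≠ t) (hx' : x.1 ≠ s) (hy' : y.1 ≠ s)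
    (hz' : z.1 ≠ s) (hL : [x, y, z] <:+: L) :
    [x, y, z] <:+: (shear s t k c (FreeGroup.mk L)).toWord := by
  obtain ⟨g, g', rfl⟩ := hL
  have e : g ++ [x, y, z] ++ g' = (g ++ [x]) ++ [y] ++ [z] ++ g' := by simp
  rw [e] at hr ⊢
  have hr1 : FreeGroup.IsReduced (g ++ [x] ++ [y] ++ [z]) :=
    hr.infix (List.prefix_append _ _).isInfix
  have hr2 : FreeGroup.IsReduced (g ++ [x] ++ [y]) := hr1.infix (List.prefix_append _ _).isInfix
  obtain ⟨h, S⟩ := exists_shearState_append (k := k) (c := c) ht hx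
    (hr2.infix (List.prefix_append _ _).isInfix)
  refine ((S.append_ne hy hr2).append_ne hz hr1).infix_of_append ht hr ?_
  exact ⟨h, [], by simp [shearShift, shearLetter, hx', hy', hz', runWord]⟩

lemma runWord_infix_shear_of_last (ht : s ≠ t) {g : List (β × Bool)} {b : Bool}
    (hr : FreeGroup.IsReduced (g ++ [(s, b)])) :
    runWord t (-k) <:+: (shear s t k c (FreeGroup.mk (g ++ [(s, b)]))).toWord := by
  obtain ⟨h, S⟩ := exists_shearState_append (z := (s, b)) (k := k) (c := c) ht ht hr
  rw [S.toWord_image]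
  simpa [shearShift] using (List.suffix_append (h ++ [shearLetter s c (s, b)])
    (runWord t (-k))).isInfix

/-- Exponents add because both shears fix `t`; the sign `false` inverts the letter `s` once more. -/
lemma shear_comp_shear (ht : s ≠ t) (l : ℤ) :
    (shear s t l false).comp (shear s t k c) = shear s t (l + k) (!c) := by
  ext x
  by_cases h : x = s
  · subst h
    simp only [MonoidHom.comp_apply, shear_of_self, map_mul, map_zpow, shear_of_ne l false ht.symm,
      shear_mk_singleton, shearShift, shearLetter, if_true, zpow_neg, zpow_add]
    cases c <;> simp [mul_assoc, shear_of_ne l false ht.symm, (Commute.zpow_zpow_self (FreeGroup.of t) _ _).eq]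
  · simp [shear_of_ne, h]

end Shear

/-! ### Words relative to a chord: crossings and folded endpoints. -/

section ChordWord

variable {n : ℕ}

/-- The side of the chord `ij` on which a letter starts. -/
def letterStart (i j : Fin n) (z : Fin n × Bool) : Bool :=
  if z.2 then sideBefore i j z.1 else sideAfter i j z.1

/-- The side of the chord `ij` on which a letter ends. -/
def letterEnd (i j : Fin n) (z : Fin n × Bool) : Bool :=
  if z.2 then sideAfter i j z.1 else sideBefore i j z.1

/-- Identify the letters of the two endpoints of the chord `ij`, the common letter being `j`. -/
def foldLetter (i j : Fin n) (z : Fin n × Bool) : Fin n × Bool :=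
  (if z.1 = i then j else z.1, z.2)

/-- The word recording a crossing of the chord, if there is one. -/
def crossWord (i : Fin n) (P Q : Bool) : List (Fin n × Bool) := if P = Q then [] else [(i, P)]

/-- The word of a path starting on the side `P` of the chord `ij`, with the crossings of the chord
recorded by the letter `i` and the loops around both endpoints by the letter `j`. -/
def chordWord (i j : Fin n) : Bool → List (Fin n × Bool) → List (Fin n × Bool)
  | P, [] => crossWord i P false
  | P, z :: L => crossWord i P (letterStart i j z) ++
      foldLetter i j z :: chordWord i j (letterEnd i j z) L

/-- The homomorphism underlying `chordWord`. -/
def chordHom (i j : Fin n) : FreeGroup (Fin n) →* FreeGroup (Fin n) :=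
  FreeGroup.lift fun k =>
    (if sideBefore i j k then FreeGroup.of i else 1)⁻¹ *
      FreeGroup.of (if k = i then j else k) * (if sideAfter i j k then FreeGroup.of i else 1)

lemma chordHom_of (i j k : Fin n) :
    chordHom i j (FreeGroup.of k) =
      (if sideBefore i j k then FreeGroup.of i else 1)⁻¹ *
        FreeGroup.of (if k = i then j else k) *
        (if sideAfter i j k then FreeGroup.of i else 1) := by
  simp [chordHom]

lemma chordHom_mk_singleton (i j : Fin n) (z : Fin n × Bool) :
    chordHom i j (FreeGroup.mk [z]) =
      (if letterStart i j z then FreeGroup.of i else 1)⁻¹ * FreeGroup.mk [foldLetter i j z] *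
        (if letterEnd i j z then FreeGroup.of i else 1) := by
  obtain ⟨k, b⟩ := z
  cases b
  · rw [mk_singleton_false, map_inv, chordHom_of]
    simp only [letterStart, letterEnd, foldLetter, mk_singleton_false, mul_inv_rev, inv_inv,
      mul_assoc, Bool.false_eq_true, if_false]
  · change chordHom i j (FreeGroup.of k) = _
    rw [chordHom_of]
    simp [letterStart, letterEnd, foldLetter, FreeGroup.of]

lemma mk_crossWord (i : Fin n) (P Q : Bool) :
    FreeGroup.mk (crossWord i P Q) =
      (if P then FreeGroup.of i else 1) * (if Q then FreeGroup.of i else 1)⁻¹ := by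
  cases P <;> cases Q <;>
    simp [crossWord, ← FreeGroup.one_eq_mk, mk_singleton_false, ← FreeGroup.of.eq_1]

lemma mk_chordWord (i j : Fin n) (P : Bool) (L : List (Fin n × Bool)) :
    FreeGroup.mk (chordWord i j P L) =
      (if P then FreeGroup.of i else 1) * chordHom i j (FreeGroup.mk L) := by
  induction L generalizing P with
  | nil => simp [chordWord, mk_crossWord, ← FreeGroup.one_eq_mk]
  | cons z L ih =>
    rw [chordWord, ← FreeGroup.mul_mk, mk_crossWord, ← List.singleton_append,
      ← FreeGroup.mul_mk, ih, ← List.singleton_append (l := L), ← FreeGroup.mul_mk, map_mul,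
      chordHom_mk_singleton]
    simp only [mul_assoc]

lemma foldLetter_fst_ne {i j : Fin n} (h : i < j) (z : Fin n × Bool) :
    (foldLetter i j z).1 ≠ i := by
  unfold foldLetter
  split_ifs with h'
  · exact h.ne'
  · exact h'

/-- Folding could only create a cancellation between a loop around `i` and an inverse loop around
`j`, or vice versa. The first then ends on the side opposite to the start of the second, so a
crossing letter separates them. -/
lemma eq_of_foldLetter {i j : Fin n} (h : i < j) {y z : Fin n × Bool}
    (hr : y.1 = z.1 → y.2 = z.2) (hs : letterEnd i j y = letterStart i j z)
    (he : (foldLetter i j y).1 = (foldLetter i j z).1) : y.2 = z.2 := by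
  obtain ⟨k, b⟩ := y
  obtain ⟨l, b'⟩ := z
  by_contra hb
  have hkl : k ≠ l := fun hkl => hb (hr hkl)
  simp only [foldLetter] at he
  simp only [letterEnd, letterStart, sideAfter, sideBefore] at hs
  split_ifs at he with h1 h2 h2
  · exact hkl (h1.trans h2.symm)
  · subst h1 he
    cases b <;> cases b' <;> simp_all
  · subst h2 he
    cases b <;> cases b' <;> simp_all
  · exact hkl he

lemma isReduced_foldLetter_cons_chordWord {i j : Fin n} (h : i < j) (z : Fin n × Bool)
    (L : List (Fin n × Bool)) (hr : FreeGroup.IsReduced (z :: L)) :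
    FreeGroup.IsReduced (foldLetter i j z :: chordWord i j (letterEnd i j z) L) := by
  induction L generalizing z with
  | nil =>
    unfold chordWord crossWord
    split_ifs
    · exact FreeGroup.IsReduced.singleton
    · exact FreeGroup.isReduced_cons_cons.2
        ⟨fun he => absurd he (foldLetter_fst_ne h z), FreeGroup.IsReduced.singleton⟩
  | cons y L ih =>
    obtain ⟨hzy, hr'⟩ := FreeGroup.isReduced_cons_cons.1 hr
    have := ih y hr'
    unfold chordWord crossWord
    split_ifs with hs
    · exact FreeGroup.isReduced_cons_cons.2 ⟨eq_of_foldLetter h hzy hs, this⟩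
    · refine FreeGroup.isReduced_cons_cons.2 ⟨fun he => absurd he (foldLetter_fst_ne h z), ?_⟩
      exact FreeGroup.isReduced_cons_cons.2
        ⟨fun he => absurd he.symm (foldLetter_fst_ne h y), this⟩

lemma isReduced_chordWord {i j : Fin n} (h : i < j) (P : Bool) (L : List (Fin n × Bool))
    (hr : FreeGroup.IsReduced L) : FreeGroup.IsReduced (chordWord i j P L) := by
  cases L with
  | nil =>
    unfold chordWord crossWord
    split_ifs
    · exact FreeGroup.IsReduced.nil
    · exact FreeGroup.IsReduced.singleton
  | cons z L =>
    have := isReduced_foldLetter_cons_chordWord h z L hr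
    unfold chordWord crossWord
    split_ifs
    · exact this
    · exact FreeGroup.isReduced_cons_cons.2
        ⟨fun he => absurd he.symm (foldLetter_fst_ne h z), this⟩

lemma toWord_chordHom {i j : Fin n} (h : i < j) (w : FreeGroup (Fin n)) :
    (chordHom i j w).toWord = chordWord i j false w.toWord := by
  have := mk_chordWord i j false w.toWord
  rw [FreeGroup.mk_toWord, if_neg Bool.false_ne_true, one_mul] at this
  rw [← this, FreeGroup.toWord_mk,
    (isReduced_chordWord h false _ FreeGroup.isReduced_toWord).reduce_eq]

lemma chordWord_append (i j : Fin n) (P : Bool) (L L' : List (Fin n × Bool)) :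
    ∃ Q K, chordWord i j P (L ++ L') = K ++ chordWord i j Q L' := by
  induction L generalizing P with
  | nil => exact ⟨P, [], by simp⟩
  | cons z L ih =>
    obtain ⟨Q, K, hK⟩ := ih (letterEnd i j z)
    exact ⟨Q, crossWord i P (letterStart i j z) ++ foldLetter i j z :: K, by
      simp [chordWord, hK]⟩

lemma pair_infix_chordWord {i j : Fin n} {P : Bool} {L : List (Fin n × Bool)}
    {y z : Fin n × Bool} (h : [y, z] <:+: L) :
    foldLetter i j y :: (crossWord i (letterEnd i j y) (letterStart i j z) ++ [foldLetter i j z])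
      <:+: chordWord i j P L := by
  obtain ⟨L₁, L₂, rfl⟩ := h
  obtain ⟨Q, K, hK⟩ := chordWord_append i j P L₁ ([y, z] ++ L₂)
  rw [List.append_assoc, hK]
  refine ⟨K ++ crossWord i Q (letterStart i j y), chordWord i j (letterEnd i j z) L₂, ?_⟩
  simp [chordWord]

lemma triple_infix_chordWord {i j : Fin n} {P : Bool} {L : List (Fin n × Bool)}
    {x y z : Fin n × Bool} (h : [x, y, z] <:+: L) (hxy : letterEnd i j x = letterStart i j y)
    (hyz : letterEnd i j y = letterStart i j z) :
    [foldLetter i j x, foldLetter i j y, foldLetter i j z] <:+: chordWord i j P L := by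
  obtain ⟨L₁, L₂, rfl⟩ := h
  obtain ⟨Q, K, hK⟩ := chordWord_append i j P L₁ ([x, y, z] ++ L₂)
  rw [List.append_assoc, hK]
  refine ⟨K ++ crossWord i Q (letterStart i j x), chordWord i j (letterEnd i j z) L₂, ?_⟩
  simp [chordWord, crossWord, hxy, hyz]

/-- The letters of the list follow each other without crossing the chord `ij`, starting on the
side `P`. -/
def IsUncrossed (i j : Fin n) : Bool → List (Fin n × Bool) → Prop
  | _, [] => True
  | P, z :: L => P = letterStart i j z ∧ IsUncrossed i j (letterEnd i j z) L

/-- After folding, the letter `i` occurs only as a crossing mark, so a block avoiding it is the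
folded image of consecutive letters with no crossing between them. -/
lemma exists_prefix_of_prefix_chordWord {i j : Fin n} {P : Bool} {C L : List (Fin n × Bool)}
    (hC : ∀ c ∈ C, c.1 ≠ i) (h : C <+: chordWord i j P L) :
    ∃ Z, Z <+: L ∧ Z.map (foldLetter i j) = C ∧ IsUncrossed i j P Z := by
  induction C generalizing P L with
  | nil => exact ⟨[], List.nil_prefix, rfl, trivial⟩
  | cons c C ih =>
    have hc : c.1 ≠ i := hC c (by simp)
    cases L with
    | nil =>
      unfold chordWord crossWord at h
      split_ifs at h
      · simp at h
      · rw [List.cons_prefix_cons] at h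
        exact absurd (by rw [h.1]) hc
    | cons z L =>
      unfold chordWord crossWord at h
      split_ifs at h with hP
      · rw [List.nil_append, List.cons_prefix_cons] at h
        obtain ⟨Z, hZ, hm, hu⟩ := ih (fun c hc => hC c (by simp [hc])) h.2
        exact ⟨z :: Z, List.cons_prefix_cons.2 ⟨rfl, hZ⟩, by simp [hm, h.1], hP, hu⟩
      · rw [List.singleton_append, List.cons_prefix_cons] at h
        exact absurd (by rw [h.1]) hc

lemma exists_infix_of_infix_chordWord {i j : Fin n} {P : Bool} {C L : List (Fin n × Bool)}
    (hC : ∀ c ∈ C, c.1 ≠ i) (h : C <:+: chordWord i j P L) :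
    ∃ Q Z, Z <:+: L ∧ Z.map (foldLetter i j) = C ∧ IsUncrossed i j Q Z := by
  induction L generalizing P with
  | nil =>
    cases C with
    | nil => exact ⟨P, [], List.nil_infix, rfl, trivial⟩
    | cons c C =>
      have : c ∈ chordWord i j P [] := h.subset (by simp)
      unfold chordWord crossWord at this
      split_ifs at this
      · simp at this
      · rw [List.mem_singleton] at this
        exact absurd (by rw [this]) (hC c (by simp))
  | cons z L ih =>
    -- The block starts at the head, just after an initial crossing mark, or later. In the second
    -- case it is a prefix of the word read from the side on which `z` starts, where no mark is
    -- written.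
    have key : C <+: chordWord i j P (z :: L) ∨ C <+: chordWord i j (letterStart i j z) (z :: L) ∨
        C <:+: chordWord i j (letterEnd i j z) L := by
      by_cases hP : P = letterStart i j z
      · rw [chordWord, crossWord, if_pos hP, List.nil_append, List.infix_cons_iff] at h
        rw [chordWord, crossWord, if_pos hP, List.nil_append]
        tauto
      · rw [chordWord, crossWord, if_neg hP, List.singleton_append, List.infix_cons_iff,
          List.infix_cons_iff] at h
        simp only [chordWord, crossWord, if_neg hP, List.singleton_append, if_true,
          List.nil_append]
        tauto
    rcases key with h | h | h
    · obtain ⟨Z, hZ, hm, hu⟩ := exists_prefix_of_prefix_chordWord hC h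
      exact ⟨_, Z, hZ.isInfix, hm, hu⟩
    · obtain ⟨Z, hZ, hm, hu⟩ := exists_prefix_of_prefix_chordWord hC h
      exact ⟨_, Z, hZ.isInfix, hm, hu⟩
    · obtain ⟨Q, Z, hZ, hm, hu⟩ := ih h
      exact ⟨Q, Z, hZ.trans (List.suffix_cons _ _).isInfix, hm, hu⟩

end ChordWord

/-! ### Spirals around a chord and their behaviour under twisting. -/

section Spiral

variable {n : ℕ}

/-- The elements of the free group whose reduced word turns at least three times around the
chord `ij`. -/
def spirals (i j : Fin n) : Set (FreeGroup (Fin n)) :=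
  {w | ∃ b, [(i, b), (j, b), (i, b)] <:+: w.toWord ∨ [(j, b), (i, b), (j, b)] <:+: w.toWord}

/-- Twisting inserts `v` exactly where `chordHom` writes the crossing letter, so both sides amount
to substituting for that letter; `hv` says that the substitutes agree. -/
lemma chordHom_crossTwist {i j : Fin n} (h : i < j) {v : FreeGroup (Fin n)} {k : ℤ} {c : Bool}
    (hv : FreeGroup.of i * chordHom i j v = shear i j k c (FreeGroup.of i))
    (w : FreeGroup (Fin n)) :
    chordHom i j (crossTwist i j v w) = shear i j k c (chordHom i j w) := by
  have : (chordHom i j).comp (crossTwist i j v) = (shear i j k c).comp (chordHom i j) := by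
    ext x
    have hx : (if x = i then j else x) ≠ i := by
      split_ifs with hx
      · exact h.ne'
      · exact hx
    simp only [MonoidHom.comp_apply, crossTwist_of, map_mul, map_inv, chordHom_of,
      shear_of_ne k c hx]
    cases sideBefore i j x <;> cases sideAfter i j x <;> simp [← hv, mul_assoc]
  exact DFunLike.congr_fun this w

lemma chordHom_left {i j : Fin n} (h : i < j) :
    chordHom i j (FreeGroup.of i) = FreeGroup.of j * FreeGroup.of i := by
  simp [chordHom_of, sideBefore, sideAfter, h]

lemma chordHom_right {i j : Fin n} (h : i < j) :
    chordHom i j (FreeGroup.of j) = (FreeGroup.of i)⁻¹ * FreeGroup.of j := by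
  simp [chordHom_of, sideBefore, sideAfter, h, h.ne']

lemma chordHom_halfTwist {i j : Fin n} (h : i < j) (w : FreeGroup (Fin n)) :
    chordHom i j (halfTwist h w) = shear i j 1 false (chordHom i j w) :=
  chordHom_crossTwist h (by
    simp [shear_of_self, chordHom_left h, chordHom_right h, mk_singleton_false, mul_assoc]) w

lemma chordHom_halfTwist_inv {i j : Fin n} (h : i < j) (w : FreeGroup (Fin n)) :
    chordHom i j ((halfTwist h)⁻¹ w) = shear i j (-1) false (chordHom i j w) :=
  chordHom_crossTwist h (by
    simp [shear_of_self, chordHom_left h, chordHom_right h, mk_singleton_false, mul_assoc]) w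

/-- Each half-twist swaps the two sides of the chord, so `c` depends on the parity of `k`. Only the
exponent `k` matters later. -/
lemma exists_shear_of_halfTwist_zpow {i j : Fin n} (h : i < j) (k : ℤ) :
    ∃ c, ∀ w, chordHom i j ((halfTwist h ^ k) w) = shear i j k c (chordHom i j w) := by
  induction k using Int.induction_on with
  | zero =>
    refine ⟨true, fun w => ?_⟩
    have : shear i j 0 true = MonoidHom.id (FreeGroup (Fin n)) := by
      ext x
      by_cases hx : x = i <;> simp [shear, hx, FreeGroup.of]
    simp [this]
  | succ k ih =>
    obtain ⟨c, hc⟩ := ih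
    refine ⟨!c, fun w => ?_⟩
    rw [add_comm, zpow_add, zpow_one, MulAut.mul_apply, chordHom_halfTwist, hc,
      ← shear_comp_shear h.ne, MonoidHom.comp_apply]
  | pred k ih =>
    obtain ⟨c, hc⟩ := ih
    refine ⟨!c, fun w => ?_⟩
    rw [sub_eq_add_neg, add_comm, zpow_add, zpow_neg_one, MulAut.mul_apply,
      chordHom_halfTwist_inv, hc, ← shear_comp_shear h.ne, MonoidHom.comp_apply]

lemma pairs_infix_of_mem_spirals {i j : Fin n} {w : FreeGroup (Fin n)} (h : w ∈ spirals i j) :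
    ∃ b, [(i, b), (j, b)] <:+: w.toWord ∧ [(j, b), (i, b)] <:+: w.toWord := by
  obtain ⟨b, h | h⟩ := h
  · exact ⟨b, List.IsInfix.trans ⟨[], [(i, b)], rfl⟩ h, List.IsInfix.trans ⟨[(i, b)], [], rfl⟩ h⟩
  · exact ⟨b, List.IsInfix.trans ⟨[(j, b)], [], rfl⟩ h, List.IsInfix.trans ⟨[], [(j, b)], rfl⟩ h⟩

lemma eq_or_eq_of_foldLetter {i j : Fin n} {z : Fin n × Bool} {b : Bool}
    (h : foldLetter i j z = (j, b)) : z = (i, b) ∨ z = (j, b) := by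
  obtain ⟨k, b'⟩ := z
  simp only [foldLetter, Prod.mk.injEq] at h
  obtain ⟨h, rfl⟩ := h
  split_ifs at h with hk
  · exact Or.inl (by rw [hk])
  · exact Or.inr (by rw [h])

/-- Three consecutive folded letters come from uncrossed loops of one sign around the endpoints. Two
such loops around the same endpoint would have a crossing between them, so the endpoints alternate.
-/
lemma mem_spirals_of_infix_chordHom {i j : Fin n} (h : i < j) {w : FreeGroup (Fin n)} {b : Bool}
    (hw : [(j, b), (j, b), (j, b)] <:+: (chordHom i j w).toWord) : w ∈ spirals i j := by
  rw [toWord_chordHom h] at hw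
  obtain ⟨Q, Z, hZ, hm, hu⟩ := exists_infix_of_infix_chordWord (by simp [h.ne']) hw
  obtain ⟨x, y, z, rfl⟩ := List.length_eq_three.1 (by simpa using congrArg List.length hm)
  simp only [List.map_cons, List.map_nil, List.cons.injEq, and_true] at hm
  obtain ⟨hx, hy, hz⟩ := hm
  obtain ⟨-, hxy, hyz, -⟩ := hu
  refine ⟨b, ?_⟩
  rcases eq_or_eq_of_foldLetter hx with rfl | rfl <;>
    rcases eq_or_eq_of_foldLetter hy with rfl | rfl <;>
    rcases eq_or_eq_of_foldLetter hz with rfl | rfl <;>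
    first
    | exact Or.inl hZ
    | exact Or.inr hZ
    | (cases b <;> simp [letterEnd, letterStart, sideBefore, sideAfter, h] at hxy hyz)

lemma mem_spirals_of_runWord_infix {i j : Fin n} (h : i < j) {w : FreeGroup (Fin n)} {r : ℤ}
    (hr : 3 ≤ |r|) (hw : runWord j r <:+: (chordHom i j w).toWord) : w ∈ spirals i j := by
  obtain ⟨b, hb⟩ := replicate_three_infix_runWord j hr
  exact mem_spirals_of_infix_chordHom h (hb.trans hw)

lemma foldLetter_eq_self {i j : Fin n} {z : Fin n × Bool} (h : z.1 ≠ i) :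
    foldLetter i j z = z := by
  simp [foldLetter, h]

/-- The crossing between `y` and `z` is a letter `s`. A neighbour that is not a loop around an
endpoint is unaffected by the shear, so the run of `t` between it and `s` is exactly `t^k` or
`t^(-k)`; a neighbouring `t` could shorten the run. -/
lemma halfTwist_zpow_mem_spirals_of_crossing {i j : Fin n} (h : i < j) {k : ℤ} (hk : 3 ≤ |k|)
    {w : FreeGroup (Fin n)} {y z : Fin n × Bool} (hw : [y, z] <:+: w.toWord)
    (hcross : letterEnd i j y ≠ letterStart i j z)
    (hyz : (y.1 ≠ i ∧ y.1 ≠ j) ∨ (z.1 ≠ i ∧ z.1 ≠ j)) :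
    (halfTwist h ^ k) w ∈ spirals i j := by
  obtain ⟨c, hc⟩ := exists_shear_of_halfTwist_zpow h k
  have hinf := pair_infix_chordWord (i := i) (j := j) (P := false) hw
  rw [crossWord, if_neg hcross, ← toWord_chordHom h] at hinf
  rcases hyz with ⟨hi, hj⟩ | ⟨hi, hj⟩
  · rw [foldLetter_eq_self hi] at hinf
    refine mem_spirals_of_runWord_infix h (r := k) hk ?_
    have := runWord_infix_shear (k := k) (c := c) h.ne FreeGroup.isReduced_toWord hj
      (z := (i, letterEnd i j y)) h.ne (List.IsInfix.trans ⟨[], [foldLetter i j z], rfl⟩ hinf)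
    rw [hc]
    simpa [shearShift, hi, FreeGroup.mk_toWord] using this
  · rw [foldLetter_eq_self hi] at hinf
    refine mem_spirals_of_runWord_infix h (r := -k) (by rwa [abs_neg]) ?_
    have := runWord_infix_shear (k := k) (c := c) h.ne FreeGroup.isReduced_toWord
      (y := (i, letterEnd i j y)) h.ne hj (List.IsInfix.trans ⟨[foldLetter i j y], [], rfl⟩ hinf)
    rw [hc]
    simpa [shearShift, hi, FreeGroup.mk_toWord] using this

/-- The transitions from `x_p` to `x_q` and back follow the two sides of the chord `pq`. If the
chords cross properly, both transitions cross `ij`; if they share one endpoint, just one does. -/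
lemma exists_crossing_of_not_disjoint {i j p q : Fin n} (h : i < j) (hpq : p < q)
    (hne : ¬ (p = i ∧ q = j)) (hd : ¬ ChordsDisjoint i j p q) :
    sideAfter i j p ≠ sideBefore i j q ∨ sideAfter i j q ≠ sideBefore i j p := by
  simp only [ChordsDisjoint, sideAfter, sideBefore, ne_eq, decide_eq_decide] at *
  omega

/-- Twisting along a chord meeting the chord `pq` turns spirals around `pq` into spirals around
the twisting chord. -/
lemma halfTwist_zpow_mem_spirals {i j p q : Fin n} (h : i < j) (hpq : p < q)
    (hne : ¬ (p = i ∧ q = j)) (hd : ¬ ChordsDisjoint i j p q) {k : ℤ} (hk : 3 ≤ |k|)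
    {w : FreeGroup (Fin n)} (hw : w ∈ spirals p q) : (halfTwist h ^ k) w ∈ spirals i j := by
  obtain ⟨b, h₁, h₂⟩ := pairs_infix_of_mem_spirals hw
  -- Distinct chords share at most one endpoint.
  have hend : (p ≠ i ∧ p ≠ j) ∨ (q ≠ i ∧ q ≠ j) := by omega
  have hcross : letterEnd i j (p, b) ≠ letterStart i j (q, b) ∨
      letterEnd i j (q, b) ≠ letterStart i j (p, b) := by
    have := exists_crossing_of_not_disjoint h hpq hne hd
    cases b
    · simpa [letterEnd, letterStart, eq_comm, or_comm] using this
    · simpa [letterEnd, letterStart] using this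
  rcases hcross with hc | hc
  · exact halfTwist_zpow_mem_spirals_of_crossing h hk h₁ hc hend
  · exact halfTwist_zpow_mem_spirals_of_crossing h hk h₂ hc hend.symm

/-- The three letters stay adjacent under `chordHom`, and the shear fixes them. As they are not
endpoints of the chord, folding is injective at them and they can be read back in the twisted word.
-/
lemma triple_infix_halfTwist_zpow {i j : Fin n} (h : i < j) (k : ℤ) {w : FreeGroup (Fin n)}
    {x y z : Fin n × Bool} (hw : [x, y, z] <:+: w.toWord) (hx : x.1 ≠ i ∧ x.1 ≠ j)
    (hy : y.1 ≠ i ∧ y.1 ≠ j) (hz : z.1 ≠ i ∧ z.1 ≠ j) (hxy : letterEnd i j x = letterStart i j y)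
    (hyz : letterEnd i j y = letterStart i j z) :
    [x, y, z] <:+: ((halfTwist h ^ k) w).toWord := by
  obtain ⟨c, hc⟩ := exists_shear_of_halfTwist_zpow h k
  have hinf := triple_infix_chordWord (P := false) hw hxy hyz
  rw [← toWord_chordHom h, foldLetter_eq_self hx.1, foldLetter_eq_self hy.1,
    foldLetter_eq_self hz.1] at hinf
  have := triple_infix_shear (k := k) (c := c) h.ne FreeGroup.isReduced_toWord
    hx.2 hy.2 hz.2 hx.1 hy.1 hz.1 hinf
  rw [FreeGroup.mk_toWord, ← hc, toWord_chordHom h] at this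
  obtain ⟨Q, Z, hZ, hm, -⟩ := exists_infix_of_infix_chordWord (by simp [hx.1, hy.1, hz.1]) this
  have hfold : ∀ {u v : Fin n × Bool}, v.1 ≠ j → foldLetter i j u = v → u = v := by
    intro u v hv huv
    by_cases hu : u.1 = i
    · rw [← huv] at hv
      simp [foldLetter, hu] at hv
    · rwa [foldLetter_eq_self hu] at huv
  obtain ⟨x', y', z', rfl⟩ := List.length_eq_three.1 (by simpa using congrArg List.length hm)
  simp only [List.map_cons, List.map_nil, List.cons.injEq, and_true] at hm
  obtain ⟨hx', hy', hz'⟩ := hm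
  rwa [hfold hx.2 hx', hfold hy.2 hy', hfold hz.2 hz'] at hZ

/-- Twisting along a chord disjoint from the chord `pq` preserves spirals around `pq`. -/
lemma halfTwist_zpow_mem_spirals_of_disjoint {i j p q : Fin n} (h : i < j) (hpq : p < q)
    (hd : ChordsDisjoint i j p q) (k : ℤ) {w : FreeGroup (Fin n)} (hw : w ∈ spirals p q) :
    (halfTwist h ^ k) w ∈ spirals p q := by
  have hp : p ≠ i ∧ p ≠ j := by simp only [ChordsDisjoint] at hd; omega
  have hq : q ≠ i ∧ q ≠ j := by simp only [ChordsDisjoint] at hd; omega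
  have hs : ∀ b, letterEnd i j (p, b) = letterStart i j (q, b) ∧
      letterEnd i j (q, b) = letterStart i j (p, b) := by
    simp only [ChordsDisjoint] at hd
    intro b
    cases b <;> simp only [letterEnd, letterStart, sideAfter, sideBefore, if_true, if_false,
      Bool.false_eq_true, decide_eq_decide] <;> omega
  obtain ⟨b, hw | hw⟩ := hw
  · exact ⟨b, Or.inl (triple_infix_halfTwist_zpow h k hw hp hq hp (hs b).1 (hs b).2)⟩
  · exact ⟨b, Or.inr (triple_infix_halfTwist_zpow h k hw hq hp hq (hs b).2 (hs b).1)⟩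

lemma halfTwist_zpow_of_mem_spirals {i j : Fin n} (h : i < j) {k : ℤ} (hk : 3 ≤ |k|) :
    (halfTwist h ^ k) (FreeGroup.of i) ∈ spirals i j := by
  obtain ⟨c, hc⟩ := exists_shear_of_halfTwist_zpow h k
  -- The image of `x_i` under `chordHom` is `t s`, sheared to `t^(k+1) s^{±1} t^(-k)`. The final run
  -- is used, since the first may have length only two.
  refine mem_spirals_of_runWord_infix h (r := -k) (by rwa [abs_neg]) ?_
  rw [hc, chordHom_left h]
  exact runWord_infix_shear_of_last (g := [(j, true)]) (b := true) h.ne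
    (FreeGroup.isReduced_cons_cons.2
      ⟨fun e => absurd e h.ne', FreeGroup.IsReduced.singleton⟩)

lemma of_notMem_spirals (i j k : Fin n) : FreeGroup.of k ∉ spirals i j := by
  rintro ⟨b, h | h⟩ <;> simpa using h.length_le

end Spiral

/-! ### The right-angled Artin group and its embedding. -/

section Main

variable {n : ℕ} (M : Matrix (Fin n) (Fin n) ℕ)

/-- The homomorphism from the right-angled Artin group of `M` to the braid group which sends
`b_{ij}` to `a_{ij} ^ m_{ij}`. -/
def raagHom : PresentedGroup (commRels M) →* BraidGroup n :=
  PresentedGroup.toGroup (f := fun σ : BandSupport M => bandPow M σ.1) (by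
    rintro r ⟨σ, τ, h, rfl⟩
    simp only [map_mul, map_inv, FreeGroup.lift_apply_of]
    rw [mul_inv_eq_one]
    exact (Commute.pow_pow h _ _).eq)

lemma raagHom_of (σ : BandSupport M) : raagHom M (PresentedGroup.of σ) = bandPow M σ.1 := by
  simp [raagHom]

lemma raagHom_range : (raagHom M).range = powerSubgroup M := by
  rw [MonoidHom.range_eq_map, ← PresentedGroup.closure_range_of, MonoidHom.map_closure,
    powerSubgroup]
  apply le_antisymm
  · apply Subgroup.closure_mono
    rintro _ ⟨_, ⟨σ, rfl⟩, rfl⟩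
    exact ⟨σ.1, (raagHom_of M σ).symm⟩
  · rw [Subgroup.closure_le]
    rintro _ ⟨σ, rfl⟩
    by_cases h : M σ.1.1 σ.1.2 = 0
    · simp [bandPow, h, one_mem]
    · exact Subgroup.subset_closure ⟨_, ⟨⟨σ, h⟩, rfl⟩, raagHom_of M ⟨σ, h⟩⟩

variable {M}

lemma closure_bandPow_eq_powerSubgroup (hM : IsLargeType M) :
    Subgroup.closure (bandPow M '' {σ | 3 ≤ M σ.1.1 σ.1.2}) = powerSubgroup M := by
  apply le_antisymm
  · exact Subgroup.closure_mono (Set.image_subset_range _ _)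
  · rw [powerSubgroup, Subgroup.closure_le]
    rintro _ ⟨σ, rfl⟩
    have := hM _ _ σ.2
    by_cases h : M σ.1.1 σ.1.2 = 0
    · simp [bandPow, h, one_mem]
    · exact Subgroup.subset_closure ⟨σ, by simp only [Set.mem_ofPred_eq]; omega, rfl⟩

lemma ChordsDisjoint.symm {i j k l : Fin n} (h : ChordsDisjoint i j k l) :
    ChordsDisjoint k l i j := by
  unfold ChordsDisjoint at *
  tauto

/-- The abstract group acts on the free group through the braid group, so an element of the kernel
acts trivially and ping-pong applies. Only the implication from disjoint chords to commuting
generators is used: the converse, and faithfulness of the braid action, are not needed. -/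
lemma raagHom_injective (hM : IsLargeType M) : Function.Injective (raagHom M) := by
  rw [injective_iff_map_eq_one]
  intro g hg
  let ρ : PresentedGroup (commRels M) →* MulAut (FreeGroup (Fin n)) :=
    (braidAction n).comp (raagHom M)
  let _ : MulAction (PresentedGroup (commRels M)) (FreeGroup (Fin n)) :=
    MulAction.compHom _ ρ
  have hsmul : ∀ (σ : BandSupport M) (k : ℤ) (w : FreeGroup (Fin n)),
      (PresentedGroup.of σ : PresentedGroup (commRels M)) ^ k • w =
        (halfTwist σ.1.2 ^ (-(M σ.1.1.1 σ.1.1.2 * k))) w := by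
    intro σ k w
    change (ρ (PresentedGroup.of σ ^ k)) w = _
    rw [map_zpow, MonoidHom.comp_apply, raagHom_of, bandPow, map_pow, braidAction_band,
      ← zpow_natCast, ← zpow_mul, inv_zpow']
  have hlarge : ∀ (σ : BandSupport M) (k : ℤ), k ≠ 0 → 3 ≤ |-((M σ.1.1.1 σ.1.1.2 : ℤ) * k)| := by
    intro σ k hk
    have h1 := hM _ _ σ.1.2
    have h2 := σ.2
    have h3 : (3 : ℤ) ≤ M σ.1.1.1 σ.1.1.2 := by omega
    have h4 : 1 ≤ |k| := Int.one_le_abs hk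
    rw [abs_neg, abs_mul, Nat.abs_cast]
    nlinarith
  refine eq_one_of_pingPong (fun σ : BandSupport M => PresentedGroup.of σ)
    (PresentedGroup.closure_range_of _)
    (fun σ τ => ChordsDisjoint σ.1.1.1 σ.1.1.2 τ.1.1.1 τ.1.1.2) ?_
    (fun σ => spirals σ.1.1.1 σ.1.1.2) (Set.range FreeGroup.of) ?_ ?_
    (fun _ _ h => h.symm) ?_ ?_ (g := g) ?_
  · intro σ τ h
    have hr : (FreeGroup.of σ * FreeGroup.of τ) * (FreeGroup.of τ * FreeGroup.of σ)⁻¹ ∈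
        commRels M := ⟨σ, τ, h.commute_band.eq, rfl⟩
    have := PresentedGroup.one_of_mem hr
    rw [map_mul, map_inv, mul_inv_eq_one] at this
    exact this
  · intro σ τ hne hd k hk w hw
    rw [hsmul]
    refine halfTwist_zpow_mem_spirals σ.1.2 τ.1.2 ?_ hd (hlarge σ k hk) hw
    rintro ⟨h1, h2⟩
    exact hne (Subtype.ext (Subtype.ext (Prod.ext h1.symm h2.symm)))
  · intro σ τ hd k _ w hw
    rw [hsmul]
    exact halfTwist_zpow_mem_spirals_of_disjoint σ.1.2 τ.1.2 hd _ hw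
  · intro σ k hk
    refine ⟨_, ⟨σ.1.1.1, rfl⟩, ?_⟩
    rw [hsmul]
    exact halfTwist_zpow_of_mem_spirals σ.1.2 (hlarge σ k hk)
  · rintro σ _ ⟨k, rfl⟩
    exact of_notMem_spirals _ _ _
  · intro w
    change (braidAction n (raagHom M g)) w = w
    rw [hg, map_one, MulAut.one_apply]

end Main

theorem theorem1 (n : ℕ) (M : Matrix (Fin n) (Fin n) ℕ) (hsymm : M.IsSymm)
    (hlarge : IsLargeType M) :
    Subgroup.closure (bandPow M '' {σ | 3 ≤ M σ.1.1 σ.1.2}) = powerSubgroup M ∧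
    ∃ φ : PresentedGroup (commRels M) ≃* powerSubgroup M,
      ∀ σ : BandSupport M, (φ (PresentedGroup.of σ) : BraidGroup n) = bandPow M σ.1 := by
  refine ⟨closure_bandPow_eq_powerSubgroup hlarge,
    (MonoidHom.ofInjective (raagHom_injective hlarge)).trans
      (MulEquiv.subgroupCongr (raagHom_range M)), fun σ => ?_⟩
  exact raagHom_of M σ
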